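/- All spaces are over $\mathbb{C}$. For a topological vector space $X$, let $X^\star$ be the space of continuous linear functionals with the topology of uniform convergence on totally bounded subsets of $X$; $X$ is *stereotype* if the canonical map $X\to X^{\star\star}$ is an isomorphism of topological vector spaces. A *stereotype algebra* is a unital associative algebra $A$ whose underlying space is stereotype and whose multiplication satisfies: for every totally bounded $S\subseteq A$ and every neighbourhood of zero $U$ there is a neighbourhood of zero $V$ with $S\cdot V\subseteq U$ and $V\cdot S\subseteq U$; it is *involutive* if it carries a continuous involution. A *(left) stereotype module* over $A$ is a left $A$-module $X$ that is a stereotype space and whose action $A\times X\to X$ is continuous in the same sense (in both arguments). The *pseudocompletion* $E^{\triangledown}$ of a locally convex space $E$ is the least linear subspace of the completion of $E$ that contains $E$ and in which every totally bounded Cauchy net converges. $\mathrm{Spec}(A)$ is the set of continuous involutive unital homomorphisms $t:A\to\mathbb{C}$ with the topology of uniform convergence on totally bounded subsets of $A$, and $I_t=\ker t$. A *locally convex bundle* with a system of seminorms $\mathcal P$ over a topological space $M$ is a bundle of vector spaces $\pi:\Xi\to M$ over $\mathbb{C}$, together with a topology on $\Xi$ and a set $\mathcal P$ of functions $p:\Xi\to[0,\infty)$,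 such that $\pi$ is continuous, open and surjective; the restrictions of the $p\in\mathcal P$ to each fibre are seminorms that define a Hausdorff locally convex topology, equal to the one induced from $\Xi$; fibrewise scalar multiplication $\mathbb{C}\times\Xi\to\Xi$ and addition $\Xi\times_M\Xi\to\Xi$ are continuous; each $p\in\mathcal P$ is upper semicontinuous on $\Xi$; and for each $t\in M$ every neighbourhood of $0_t$ in $\Xi$ contains a set $\{\xi:\pi(\xi)\in U,\ p(\xi)<\varepsilon\}$ with $p\in\mathcal P$, $\varepsilon>0$, $U\ni t$ open in $M$. $\mathrm{Sec}(\pi)$ is the $C(M)$-module of continuous sections, with the topology of uniform convergence on compact sets, i.e. given by the seminorms $s\mapsto\sup_{t\in T}p(s(t))$, $p\in\mathcal P$, $T\subseteq M$ compact. **Theorem.** Let $X$ be a stereotype module over an involutive stereotype algebra $A$ and $n\in\mathbb{Z}_{\ge 0}$. For $t\in\mathrm{Spec}(A)$ put $$J^n_t(X)=\big(X/\overline{I_t^{\,n+1}\cdot X}\big)^{\triangledown},\qquad J^n_A(X)=\bigsqcup_{t\in\mathrm{Spec}(A)}J^n_t(X),$$ where $I_t^{\,n+1}$ is the span of products of $n+1$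 elements of $I_t$ and $I_t^{\,n+1}\cdot X$ is the set of finite sums of elements $a\cdot x$, $a\in I_t^{\,n+1}$, $x\in X$. Let $\pi^n:J^n_A(X)\to\mathrm{Spec}(A)$ be the projection, let $j^n(x)(t)=x+\overline{I_t^{\,n+1}\cdot X}$ for $x\in X$, and for a continuous seminorm $p$ on $X$ let $p^n$ be the function on $J^n_A(X)$ whose restriction $p^n_t$ to $J^n_t(X)$ is the continuous extension of the quotient seminorm $p^n_t(x+\overline{I_t^{\,n+1}\cdot X})=\inf\{p(x+y): y\in\overline{I_t^{\,n+1}\cdot X}\}$. Then there is exactly one topology on $J^n_A(X)$ that makes $\pi^n$ a locally convex bundle with the system of seminorms $\{p^n\}$ ($p$ ranging over all continuous seminorms on $X$) and all sections $j^n(x)$, $x\in X$, continuous. For this topology the map $x\mapsto j^n(x)$ is continuous from $X$ to $\mathrm{Sec}(\pi^n)$; $\mathrm{Sec}(\pi^n)$, with $A$ acting by $(a\cdot s)(t)=t(a)\,s(t)$, is an $A$-module with jointly continuous action; and the sets $$W(x,U,p,\varepsilon)=\big\{\xi\in J^n_A(X):\ \pi^n(\xi)\in U,\ p^n_{\pi^n(\xi)}\big(\xi-j^n(x)(\pi^n(\xi))\big)<\varepsilon\big\},$$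 with $x\in X$, $U\subseteq\mathrm{Spec}(A)$ open, $p$ a continuous seminorm on $X$ and $\varepsilon>0$, form a base of the topology. -/

import Mathlib

open Topology Filter TopologicalSpace

noncomputable section

/-! ### Stereotype spaces -/

section Stereotype

variable (X : Type*) [AddCommGroup X] [Module ℂ X] [UniformSpace X]

/-- The stereotype dual `X⋆`: all continuous linear functionals on `X`, with the topology of
uniform convergence on totally bounded subsets of `X`. -/
abbrev StereotypeDual : Type _ :=
  UniformConvergenceCLM (RingHom.id ℂ) ℂ {S : Set X | TotallyBounded S}

variable {X} in
/-- Evaluation at a point is continuous on the stereotype dual. -/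
theorem StereotypeDual.continuous_eval (x : X) :
    Continuous fun f : StereotypeDual X => f x := by
  have : ContinuousEvalConst (StereotypeDual X) X ℂ :=
    UniformConvergenceCLM.continuousEvalConst (RingHom.id ℂ) ℂ _ (by
      refine Set.eq_univ_of_forall fun y => Set.mem_sUnion.2 ⟨{y}, ?_, rfl⟩
      exact Set.finite_singleton y |>.totallyBounded)
  exact continuous_eval_const x

variable {X} in
/-- The canonical map `X → X⋆⋆`, `x ↦ (f ↦ f x)`. -/
def stereotypeBidualMap (x : X) : StereotypeDual (StereotypeDual X) :=
  ({ toFun := fun f => f x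
     map_add' := fun _ _ => rfl
     map_smul' := fun _ _ => rfl
     cont := StereotypeDual.continuous_eval x } : StereotypeDual X →L[ℂ] ℂ)

/-- A topological vector space over `ℂ` is stereotype if the canonical map `X → X⋆⋆` is an
isomorphism of topological vector spaces (the map is linear, so it has to be a homeomorphism;
since `X⋆⋆` is Hausdorff and locally convex, so is then `X`). -/
def IsStereotype : Prop :=
  IsHomeomorph (stereotypeBidualMap : X → StereotypeDual (StereotypeDual X))

end Stereotype

/-- A bilinear operation `A × X → Y` is continuous in the sense of stereotype theory: for every
totally bounded set of one argument and every neighbourhood of zero `U` in the target there is a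
neighbourhood of zero of the other argument such that the products land in `U`. -/
def StereotypeContinuous₂ {A X Y : Type*} [Zero A] [UniformSpace A] [Zero X] [UniformSpace X]
    [Zero Y] [TopologicalSpace Y] (m : A → X → Y) : Prop :=
  (∀ S : Set A, TotallyBounded S → ∀ U ∈ 𝓝 (0 : Y), ∃ V ∈ 𝓝 (0 : X),
      ∀ a ∈ S, ∀ x ∈ V, m a x ∈ U) ∧
  (∀ S : Set X, TotallyBounded S → ∀ U ∈ 𝓝 (0 : Y), ∃ V ∈ 𝓝 (0 : A),
      ∀ a ∈ V, ∀ x ∈ S, m a x ∈ U)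

/-- A (unital, associative) algebra over `ℂ` that is a stereotype space with a multiplication
continuous in the stereotype sense. -/
structure IsStereotypeAlgebra (A : Type*) [Ring A] [Algebra ℂ A] [UniformSpace A]
    [IsUniformAddGroup A] [ContinuousSMul ℂ A] : Prop where
  stereotype : IsStereotype A
  mul : StereotypeContinuous₂ fun a b : A => a * b

/-- A left `A`-module that is a stereotype space with an action of `A` continuous in the
stereotype sense. -/
structure IsStereotypeModule (A X : Type*) [Ring A] [UniformSpace A]
    [AddCommGroup X] [Module ℂ X] [Module A X] [UniformSpace X]
    [IsUniformAddGroup X] [ContinuousSMul ℂ X] : Prop where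
  stereotype : IsStereotype X
  smul : StereotypeContinuous₂ fun (a : A) (x : X) => a • x

/-! ### Pseudocompletion -/

/-- A uniform space is pseudocomplete if every totally bounded Cauchy net (here: Cauchy filter
containing a totally bounded set) converges. -/
def IsPseudocomplete (E : Type*) [UniformSpace E] : Prop :=
  ∀ f : Filter E, Cauchy f → (∃ S ∈ f, TotallyBounded S) → ∃ x, f ≤ 𝓝 x

section Pseudocompletion

variable (E : Type*) [AddCommGroup E] [Module ℂ E] [UniformSpace E] [IsUniformAddGroup E]
  [UniformContinuousConstSMul ℂ E]

/-- The pseudocompletion `E^▽`: the least pseudocomplete vector subspace of the completion of `E`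
that contains `E`. -/
def pseudocompletion : Submodule ℂ (UniformSpace.Completion E) :=
  sInf {S | (∀ x : E, (x : UniformSpace.Completion E) ∈ S) ∧ IsPseudocomplete S}

variable {E} in
theorem coe_mem_pseudocompletion (x : E) :
    (x : UniformSpace.Completion E) ∈ pseudocompletion E :=
  Submodule.mem_sInf.2 fun _ hS => hS.1 x

/-- The canonical map `E → E^▽`. -/
def toPseudocompletion : E →ₗ[ℂ] pseudocompletion E where
  toFun x := ⟨x, coe_mem_pseudocompletion x⟩
  map_add' x y := Subtype.ext (UniformSpace.Completion.coe_add x y)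
  map_smul' c x := Subtype.ext (UniformSpace.Completion.coe_smul c x)

variable {E} in
theorem Seminorm.uniformContinuous_aux (p : Seminorm ℂ E) (hp : Continuous p) :
    UniformContinuous p :=
  Seminorm.uniformContinuous_of_continuousAt_zero hp.continuousAt

variable {E} in
/-- The extension by continuity of a continuous seminorm to the completion. -/
def completionSeminorm (p : Seminorm ℂ E) (hp : Continuous p) :
    Seminorm ℂ (UniformSpace.Completion E) :=
  have hu := p.uniformContinuous_aux hp
  Seminorm.of (UniformSpace.Completion.extension p)
    (fun x y => by
      refine UniformSpace.Completion.induction_on₂ x y ?_ fun a b => ?_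
      · exact isClosed_le
          (UniformSpace.Completion.continuous_extension.comp (continuous_fst.add continuous_snd))
          ((UniformSpace.Completion.continuous_extension.comp continuous_fst).add
            (UniformSpace.Completion.continuous_extension.comp continuous_snd))
      · rw [← UniformSpace.Completion.coe_add, UniformSpace.Completion.extension_coe hu,
          UniformSpace.Completion.extension_coe hu, UniformSpace.Completion.extension_coe hu]
        exact map_add_le_add p a b)
    (fun c x => by
      refine UniformSpace.Completion.induction_on x ?_ fun a => ?_
      · exact isClosed_eq
          (UniformSpace.Completion.continuous_extension.comp (continuous_const_smul c))
          (continuous_const.mul UniformSpace.Completion.continuous_extension)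
      · rw [← UniformSpace.Completion.coe_smul, UniformSpace.Completion.extension_coe hu,
          UniformSpace.Completion.extension_coe hu]
        exact map_smul_eq_mul p c a)

end Pseudocompletion

/-! ### Quotients -/

section Quotient

variable {X : Type*} [AddCommGroup X] [Module ℂ X]

/-- The quotient seminorm `x + N ↦ inf {p (x + y) | y ∈ N}`. -/
def quotientSeminorm (p : Seminorm ℂ X) (N : Submodule ℂ X) : Seminorm ℂ (X ⧸ N) :=
  have hb : ∀ q : X ⧸ N, BddBelow (p '' {x | N.mkQ x = q}) := fun q =>
    ⟨0, by rintro _ ⟨x, -, rfl⟩; exact apply_nonneg p x⟩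
  have hn : ∀ q : X ⧸ N, (p '' {x | N.mkQ x = q}).Nonempty := fun q =>
    (N.mkQ_surjective q).elim fun x hx => ⟨p x, x, hx, rfl⟩
  Seminorm.ofSMulLE (fun q => sInf (p '' {x | N.mkQ x = q}))
    (le_antisymm (csInf_le (hb 0) ⟨0, by simp, by simp⟩)
      (le_csInf (hn 0) (by rintro _ ⟨x, -, rfl⟩; exact apply_nonneg p x)))
    (fun q r => by
      refine le_of_forall_pos_lt_add fun ε hε => ?_
      obtain ⟨_, ⟨x, hx, rfl⟩, hx'⟩ := Real.lt_sInf_add_pos (hn q) (half_pos hε)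
      obtain ⟨_, ⟨y, hy, rfl⟩, hy'⟩ := Real.lt_sInf_add_pos (hn r) (half_pos hε)
      have h1 : sInf (p '' {x | N.mkQ x = q + r}) ≤ p (x + y) :=
        csInf_le (hb _) ⟨x + y, by
          have hx1 : N.mkQ x = q := hx
          have hy1 : N.mkQ y = r := hy
          show N.mkQ (x + y) = q + r
          rw [map_add, hx1, hy1], rfl⟩
      have h2 := map_add_le_add p x y
      linarith)
    (fun c q => by
      refine le_of_forall_pos_lt_add fun ε hε => ?_
      have hc : 0 < ‖c‖ + 1 := by positivity
      obtain ⟨_, ⟨x, hx, rfl⟩, hx'⟩ := Real.lt_sInf_add_pos (hn q) (div_pos hε hc)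
      have hx1 : N.mkQ x = q := hx
      have h1 : sInf (p '' {x | N.mkQ x = c • q}) ≤ p (c • x) :=
        csInf_le (hb _) ⟨c • x, by
          show N.mkQ (c • x) = c • q
          rw [map_smul, hx1], rfl⟩
      rw [map_smul_eq_mul] at h1
      have h2 : ‖c‖ * p x ≤ ‖c‖ * (sInf (p '' {x | N.mkQ x = q}) + ε / (‖c‖ + 1)) :=
        mul_le_mul_of_nonneg_left hx'.le (norm_nonneg c)
      have h3 : ‖c‖ * (ε / (‖c‖ + 1)) < ε := by
        rw [← mul_div_assoc, div_lt_iff₀ hc]; nlinarith [norm_nonneg c]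
      linarith [mul_add ‖c‖ (sInf (p '' {x | N.mkQ x = q})) (ε / (‖c‖ + 1))])

theorem quotientSeminorm_mk (p : Seminorm ℂ X) (N : Submodule ℂ X) (x : X) :
    quotientSeminorm p N (N.mkQ x) = ⨅ y : N, p (x + y) := by
  have : p '' {z | N.mkQ z = N.mkQ x} = Set.range fun y : N => p (x + y) := by
    ext r
    constructor
    · rintro ⟨z, hz, rfl⟩
      have : z - x ∈ N := (Submodule.Quotient.eq N).1 hz
      exact ⟨⟨z - x, this⟩, by simp⟩
    · rintro ⟨y, rfl⟩
      exact ⟨x + y, by simp, rfl⟩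
  exact congrArg sInf this

variable [UniformSpace X] [IsUniformAddGroup X] [ContinuousSMul ℂ X]

theorem continuous_quotientSeminorm (p : Seminorm ℂ X) (hp : Continuous p)
    (N : Submodule ℂ X) : Continuous (quotientSeminorm p N) := by
  have h : ((quotientSeminorm p N).comp N.mkQ) ≤ p := fun x => by
    show quotientSeminorm p N (N.mkQ x) ≤ p x
    rw [quotientSeminorm_mk]
    refine (ciInf_le ⟨0, ?_⟩ (0 : N)).trans (by simp)
    rintro _ ⟨y, rfl⟩
    exact apply_nonneg p _
  have h2 : Continuous ((quotientSeminorm p N).comp N.mkQ) := Seminorm.continuous_of_le hp h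
  exact (Submodule.isQuotientMap_mkQ N).continuous_iff.2 h2

/-- The uniform structure of the quotient topological vector space `X ⧸ N`. -/
instance quotientUniformSpace (N : Submodule ℂ X) : UniformSpace (X ⧸ N) :=
  IsTopologicalAddGroup.rightUniformSpace (X ⧸ N)

instance quotientIsUniformAddGroup (N : Submodule ℂ X) : IsUniformAddGroup (X ⧸ N) :=
  isUniformAddGroup_of_addCommGroup

instance quotientUniformContinuousConstSMul (N : Submodule ℂ X) :
    UniformContinuousConstSMul ℂ (X ⧸ N) :=
  uniformContinuousConstSMul_of_continuousConstSMul ℂ (X ⧸ N)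

end Quotient

/-! ### Locally convex bundles

A bundle of vector spaces over `M` is given by its fibres `E t`, `t : M`; its total space is
`Σ t, E t` and its projection is `Sigma.fst`.  A set of functions on the total space whose
restrictions to the fibres are seminorms is given as a family `P : ι → ∀ t, Seminorm ℂ (E t)`. -/

section Bundles

variable {M : Type*} [TopologicalSpace M] {E : M → Type*} [∀ t, AddCommGroup (E t)]
  [∀ t, Module ℂ (E t)] {ι : Type*}

/-- `τ` makes the projection `Σ t, E t → M` a locally convex bundle with the system of
seminorms `P`. -/
structure IsLocallyConvexBundle (P : ι → ∀ t, Seminorm ℂ (E t))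
    (τ : TopologicalSpace (Σ t, E t)) : Prop where
  continuous_proj : Continuous (fun ξ : Σ t, E t => ξ.1)
  isOpenMap_proj : IsOpenMap (fun ξ : Σ t, E t => ξ.1)
  /-- the seminorms separate the points of each fibre -/
  separating : ∀ t (v : E t), (∀ i, P i t v = 0) → v = 0
  /-- the topology that the seminorms define on a fibre is the one induced by `τ` -/
  fibre_topology : ∀ t, TopologicalSpace.induced (fun v : E t => (⟨t, v⟩ : Σ t, E t)) τ =
    ⨅ i, (P i t).toSeminormedAddCommGroup.toUniformSpace.toTopologicalSpace
  continuous_smul :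
    Continuous fun z : ℂ × (Σ t, E t) => (⟨z.2.1, z.1 • z.2.2⟩ : Σ t, E t)
  /-- continuity of the fibrewise addition; the fibre product of `Σ t, E t` with itself over `M`
  is `Σ t, E t × E t` with the topology induced from the product -/
  continuous_add :
    Continuous[TopologicalSpace.induced
      (fun z : Σ t, E t × E t => ((⟨z.1, z.2.1⟩, ⟨z.1, z.2.2⟩) : (Σ t, E t) × (Σ t, E t)))
      inferInstance, τ] fun z => (⟨z.1, z.2.1 + z.2.2⟩ : Σ t, E t)
  upperSemicontinuous : ∀ i, UpperSemicontinuous fun ξ : Σ t, E t => P i ξ.1 ξ.2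
  nhds_zero : ∀ t, ∀ V ∈ 𝓝 (⟨t, 0⟩ : Σ t, E t), ∃ i, ∃ ε : ℝ, 0 < ε ∧
    ∃ U : Set M, IsOpen U ∧ t ∈ U ∧ {ξ : Σ t, E t | ξ.1 ∈ U ∧ P i ξ.1 ξ.2 < ε} ⊆ V

variable {P : ι → ∀ t, Seminorm ℂ (E t)} {τ : TopologicalSpace (Σ t, E t)}

theorem IsLocallyConvexBundle.continuous_smul_section (h : IsLocallyConvexBundle P τ)
    {s : ∀ t, E t} (hs : Continuous fun t => (⟨t, s t⟩ : Σ t, E t)) (f : C(M, ℂ)) :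
    Continuous fun t => (⟨t, f t • s t⟩ : Σ t, E t) :=
  h.continuous_smul.comp (f.continuous.prodMk hs)

theorem IsLocallyConvexBundle.continuous_add_section (h : IsLocallyConvexBundle P τ)
    {s r : ∀ t, E t} (hs : Continuous fun t => (⟨t, s t⟩ : Σ t, E t))
    (hr : Continuous fun t => (⟨t, r t⟩ : Σ t, E t)) :
    Continuous fun t => (⟨t, s t + r t⟩ : Σ t, E t) := by
  let _ : TopologicalSpace (Σ t, E t × E t) := TopologicalSpace.induced
      (fun z : Σ t, E t × E t => ((⟨z.1, z.2.1⟩, ⟨z.1, z.2.2⟩) : (Σ t, E t) × (Σ t, E t)))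
      inferInstance
  have h1 : Continuous fun t => (⟨t, s t, r t⟩ : Σ t, E t × E t) :=
    continuous_induced_rng.2 (hs.prodMk hr)
  exact Continuous.comp (g := fun z : Σ t, E t × E t => (⟨z.1, z.2.1 + z.2.2⟩ : Σ t, E t))
    h.continuous_add h1

theorem IsLocallyConvexBundle.continuous_zero_section (h : IsLocallyConvexBundle P τ) :
    Continuous fun t => (⟨t, 0⟩ : Σ t, E t) := by
  rw [continuous_iff_continuousAt]
  intro t V hV
  obtain ⟨i, ε, hε, U, hU, htU, hUV⟩ := h.nhds_zero t V hV
  refine mem_map.2 (mem_of_superset (hU.mem_nhds htU) fun s hs => hUV ⟨hs, ?_⟩)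
  simpa using hε

/-- The space `Sec(π)` of continuous sections of a locally convex bundle. -/
def IsLocallyConvexBundle.Sec (h : IsLocallyConvexBundle P τ) : Submodule ℂ (∀ t, E t) where
  carrier := {s | Continuous fun t => (⟨t, s t⟩ : Σ t, E t)}
  add_mem' hs hr := h.continuous_add_section hs hr
  zero_mem' := h.continuous_zero_section
  smul_mem' c _ hs := h.continuous_smul_section hs (ContinuousMap.const M c)

/-- `Sec(π)` is a module over `C(M)` with pointwise multiplication. -/
instance IsLocallyConvexBundle.secModule (h : IsLocallyConvexBundle P τ) :
    Module C(M, ℂ) h.Sec where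
  smul f s := ⟨fun t => f t • s.1 t, h.continuous_smul_section s.2 f⟩
  one_smul s := Subtype.ext (funext fun t => one_smul ℂ (s.1 t))
  mul_smul f g s := Subtype.ext (funext fun t => mul_smul (f t) (g t) (s.1 t))
  smul_zero f := Subtype.ext (funext fun t => smul_zero (f t))
  smul_add f s r := Subtype.ext (funext fun t => smul_add (f t) (s.1 t) (r.1 t))
  add_smul f g s := Subtype.ext (funext fun t => add_smul (f t) (g t) (s.1 t))
  zero_smul s := Subtype.ext (funext fun t => zero_smul ℂ (s.1 t))

theorem IsLocallyConvexBundle.bddAbove_sec (h : IsLocallyConvexBundle P τ) (i : ι)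
    (T : Compacts M) (s : h.Sec) :
    BddAbove (Set.range fun t : T => P i t (s.1 t)) := by
  have hu : UpperSemicontinuous fun t : M => P i t (s.1 t) :=
    (h.upperSemicontinuous i).comp s.2
  have := (hu.upperSemicontinuousOn (T : Set M)).bddAbove_of_isCompact T.isCompact
  refine this.mono ?_
  rintro _ ⟨t, rfl⟩
  exact ⟨t, t.2, rfl⟩

/-- The seminorm `s ↦ sup {p (s t) | t ∈ T}` on `Sec(π)`, for a compact set `T` in the base. -/
def IsLocallyConvexBundle.secSeminorm (h : IsLocallyConvexBundle P τ) (i : ι)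
    (T : Compacts M) : Seminorm ℂ h.Sec :=
  Seminorm.of (fun s => ⨆ t : T, P i t (s.1 t))
    (fun s r => by
      refine Real.iSup_le (fun t => ?_) (add_nonneg
        (Real.iSup_nonneg fun _ => apply_nonneg _ _) (Real.iSup_nonneg fun _ => apply_nonneg _ _))
      exact (map_add_le_add (P i t) (s.1 t) (r.1 t)).trans
        (add_le_add (le_ciSup (h.bddAbove_sec i T s) t) (le_ciSup (h.bddAbove_sec i T r) t)))
    (fun c s => by
      rw [Real.mul_iSup_of_nonneg (norm_nonneg c)]
      exact iSup_congr fun t => map_smul_eq_mul (P i t) c (s.1 t))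

/-- The topology of `Sec(π)`: uniform convergence on compact sets of the base, that is, the
topology defined by the seminorms `secSeminorm`. -/
instance IsLocallyConvexBundle.secTopologicalSpace (h : IsLocallyConvexBundle P τ) :
    TopologicalSpace h.Sec :=
  ⨅ (i : ι) (T : Compacts M),
    (h.secSeminorm i T).toSeminormedAddCommGroup.toUniformSpace.toTopologicalSpace

end Bundles

/-! ### The involutive spectrum and the jet spaces -/

section Spectrum

variable (A : Type*) [Ring A] [Algebra ℂ A] [UniformSpace A] [IsUniformAddGroup A]
  [ContinuousSMul ℂ A] [StarRing A]

/-- The involutive spectrum `Spec(A)`: continuous unital involutive homomorphisms `A → ℂ`, with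
the topology of uniform convergence on totally bounded sets. -/
def InvolutiveSpectrum : Type _ :=
  {t : StereotypeDual A // t 1 = 1 ∧ (∀ a b, t (a * b) = t a * t b) ∧
    ∀ a, t (star a) = star (t a)}

instance : TopologicalSpace (InvolutiveSpectrum A) :=
  inferInstanceAs (TopologicalSpace {t : StereotypeDual A // _})

variable {A}

/-- The ideal `I_t = {a | t a = 0}` as a linear subspace of `A`. -/
def InvolutiveSpectrum.ideal (t : InvolutiveSpectrum A) : Submodule ℂ A where
  carrier := {a | t.1 a = 0}
  add_mem' {a b} ha hb := by
    show t.1 (a + b) = 0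
    rw [map_add, show t.1 a = 0 from ha, show t.1 b = 0 from hb, add_zero]
  zero_mem' := map_zero t.1
  smul_mem' c a ha := by
    show t.1 (c • a) = 0
    rw [map_smul, show t.1 a = 0 from ha, smul_zero]

variable (A) in
/-- The homomorphism `σ : A → C(Spec(A))`, `σ(a)(t) = t(a)`. -/
def spectrumHom : A →ₐ[ℂ] C(InvolutiveSpectrum A, ℂ) where
  toFun a := ⟨fun t => t.1 a, (StereotypeDual.continuous_eval a).comp continuous_subtype_val⟩
  map_one' := ContinuousMap.ext fun t => t.2.1
  map_mul' a b := ContinuousMap.ext fun t => t.2.2.1 a b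
  map_zero' := ContinuousMap.ext fun t => map_zero t.1
  map_add' a b := ContinuousMap.ext fun t => map_add t.1 a b
  commutes' c := ContinuousMap.ext fun t => by
    show t.1 (algebraMap ℂ A c) = c
    rw [Algebra.algebraMap_eq_smul_one, map_smul, t.2.1]
    simp

end Spectrum

section Jets

variable {A : Type*} [Ring A] [Algebra ℂ A] [UniformSpace A] [IsUniformAddGroup A]
  [ContinuousSMul ℂ A] [StarRing A]
variable (X : Type*) [AddCommGroup X] [Module ℂ X] [Module A X] [UniformSpace X]
  [IsUniformAddGroup X] [ContinuousSMul ℂ X]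

/-- The closed subspace `closure (I_t^{n+1}·X)` of `X`.  Here `I_t^{n+1}` is the span of the
products of `n + 1` elements of `I_t` (power of a linear subspace of an algebra), and
`I_t^{n+1}·X` is the set of finite sums of elements `a • x`, `a ∈ I_t^{n+1}`, `x ∈ X`. -/
def jetSubmodule (n : ℕ) (t : InvolutiveSpectrum A) : Submodule ℂ X :=
  (Submodule.span ℂ {y | ∃ a ∈ t.ideal ^ (n + 1), ∃ x : X, a • x = y}).topologicalClosure

/-- The jet space `J^n_t(X) = (X / closure (I_t^{n+1}·X))^▽`. -/
def Jet (n : ℕ) (t : InvolutiveSpectrum A) : Type _ :=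
  pseudocompletion (X ⧸ jetSubmodule X n t)

instance (n : ℕ) (t : InvolutiveSpectrum A) : AddCommGroup (Jet X n t) :=
  inferInstanceAs (AddCommGroup (pseudocompletion (X ⧸ jetSubmodule X n t)))

instance (n : ℕ) (t : InvolutiveSpectrum A) : Module ℂ (Jet X n t) :=
  inferInstanceAs (Module ℂ (pseudocompletion (X ⧸ jetSubmodule X n t)))

/-- The seminorm `p^n_t` on `J^n_t(X)` defined by a continuous seminorm `p` on `X`: the quotient
seminorm, extended by continuity to the pseudocompletion. -/
def jetSeminorm (n : ℕ) (p : {p : Seminorm ℂ X // Continuous p}) (t : InvolutiveSpectrum A) :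
    Seminorm ℂ (Jet X n t) :=
  (completionSeminorm (quotientSeminorm p.1 (jetSubmodule X n t))
    (continuous_quotientSeminorm p.1 p.2 _)).comp
      (pseudocompletion (X ⧸ jetSubmodule X n t)).subtype

variable {X}

/-- The section `j^n(x)`, `j^n(x)(t) = x + closure (I_t^{n+1}·X)`. -/
def jet (n : ℕ) (x : X) (t : InvolutiveSpectrum A) : Jet X n t :=
  toPseudocompletion (X ⧸ jetSubmodule X n t) ((jetSubmodule X n t).mkQ x)

/-- The set `W(x, U, p, ε)` of all `ξ` in the jet bundle with `π(ξ) ∈ U` and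
`p^n_{π(ξ)}(ξ - j^n(x)(π(ξ))) < ε`. -/
def jetBasicSet (n : ℕ) (x : X) (U : Set (InvolutiveSpectrum A))
    (p : {p : Seminorm ℂ X // Continuous p}) (ε : ℝ) :
    Set (Σ t : InvolutiveSpectrum A, Jet X n t) :=
  {ξ | ξ.1 ∈ U ∧ jetSeminorm X n p ξ.1 (ξ.2 - jet n x ξ.1) < ε}

end Jets

end

/-!
Call a family of sections of a bundle dense if its values are dense in every fibre. In a locally
convex bundle the tubes `W(x, U, p, ε)` around continuous sections are open, because `p` is upper
semicontinuous; if the family is dense, they form a base, because every neighbourhood of `v` over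
`t` contains a tube around a section that passes close enough to `v`. This determines the topology.

Conversely, a linear dense family `j` makes the fibres into a bundle as soon as all the functions
`t ↦ p (j x t)` are upper semicontinuous: differences of sections of the family belong to the
family, so a small tube around `j z` lies locally in a given tube around `j x` once its centre does.

For jets, `p (j x t)` is the infimum of the values `p (x + y)` over `y ∈ I_t ^ (n + 1) • X`, which
is upper semicontinuous in `t` because each such `y` moves continuously with `t`: if `t` kills
`b₀, …, bₙ`, then `s ↦ (b₀ - s b₀) ⋯ (bₙ - s bₙ)` is a selection of `I_s ^ (n + 1)` through
`b₀ ⋯ bₙ`, and its action on a vector is continuous in `s`.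
-/

section SeminormFamilies

variable {𝕜 E ι : Type*} [NormedField 𝕜] [AddCommGroup E] [Module 𝕜 E]

theorem withSeminorms_iInf_toSeminormedAddCommGroup (p : SeminormFamily 𝕜 E ι) :
    WithSeminorms (topology :=
      ⨅ i, (p i).toSeminormedAddCommGroup.toUniformSpace.toTopologicalSpace) p := by
  let _ : TopologicalSpace E :=
    ⨅ i, (p i).toSeminormedAddCommGroup.toUniformSpace.toTopologicalSpace
  have : IsTopologicalAddGroup E := topologicalAddGroup_iInf fun i =>
    let _ := (p i).toSeminormedAddCommGroup
    inferInstance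
  exact p.withSeminorms_iff_topologicalSpace_eq_iInf.2 rfl

theorem exists_ball_subset_of_directed [TopologicalSpace E] [Nonempty ι]
    {p : SeminormFamily 𝕜 E ι} (hp : WithSeminorms p) (hdir : Directed (· ≤ ·) p) {x : E}
    {U : Set E} (hU : U ∈ 𝓝 x) : ∃ i, ∃ ε > 0, (p i).ball x ε ⊆ U := by
  obtain ⟨s, ε, hε, hsU⟩ := (hp.mem_nhds_iff x U).1 hU
  obtain ⟨i, hi⟩ := hdir.finset_le s
  exact ⟨i, ε, hε, (Seminorm.ball_antitone (Finset.sup_le hi)).trans hsU⟩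

variable (𝕜 E) in
theorem directed_continuousSeminorms [TopologicalSpace E] :
    Directed (· ≤ ·) fun p : {p : Seminorm 𝕜 E // Continuous p} => p.1 := fun p q =>
  ⟨⟨p.1 ⊔ q.1, p.2.sup q.2⟩, le_sup_left, le_sup_right⟩

theorem seminorm_smul_sub_smul_le (p : Seminorm 𝕜 E) (a c : 𝕜) (x y : E) :
    p (a • x - c • y) ≤ ‖a‖ * p (x - y) + ‖a - c‖ * p y := by
  have hsplit : a • x - c • y = a • (x - y) + (a - c) • y := by
    rw [smul_sub, sub_smul]; abel
  rw [hsplit, ← map_smul_eq_mul, ← map_smul_eq_mul]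
  exact map_add_le_add p _ _

end SeminormFamilies

section SectionTopology

variable {M : Type*} {E : M → Type*} [∀ t, AddCommGroup (E t)]
  [∀ t, Module ℂ (E t)] {ι X : Type*}

/-- The set of all points `ξ` of the total space that lie over `U` and are `ε`-close to the section
`j x` with respect to `P i`. -/
def sectionTube (P : ι → ∀ t, Seminorm ℂ (E t)) (j : X → ∀ t, E t) (x : X) (U : Set M)
    (i : ι) (ε : ℝ) : Set (Σ t, E t) :=
  {ξ | ξ.1 ∈ U ∧ P i ξ.1 (ξ.2 - j x ξ.1) < ε}

/-- The values at `t` of the sections `j x` are dense in the fibre over `t` for each single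
seminorm `P i t`. For directed `P` this is density in the topology of the fibre. -/
def FibrewiseDense (P : ι → ∀ t, Seminorm ℂ (E t)) (j : X → ∀ t, E t) : Prop :=
  ∀ i t (v : E t) (ε : ℝ), 0 < ε → ∃ x, P i t (v - j x t) < ε

/-- The topology of the fibre product of the total space with itself over the base. -/
abbrev fibreProductTopology (τ : TopologicalSpace (Σ t, E t)) :
    TopologicalSpace (Σ t, E t × E t) :=
  induced (fun z => ((⟨z.1, z.2.1⟩, ⟨z.1, z.2.2⟩) : (Σ t, E t) × (Σ t, E t)))
    (@instTopologicalSpaceProd _ _ τ τ)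

theorem exists_section_mem [Nonempty ι] {P : ι → ∀ t, Seminorm ℂ (E t)} {j : X → ∀ t, E t}
    {τ : TopologicalSpace (Σ t, E t)} {t : M}
    (hfibre : induced (fun v : E t => (⟨t, v⟩ : Σ t, E t)) τ =
      ⨅ i, (P i t).toSeminormedAddCommGroup.toUniformSpace.toTopologicalSpace)
    (hdir : Directed (· ≤ ·) P) (hdense : FibrewiseDense P j) {v : E t} {V : Set (Σ t, E t)}
    (hV : V ∈ 𝓝 (⟨t, v⟩ : Σ t, E t)) (i : ι) {ε : ℝ} (hε : 0 < ε) :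
    ∃ x, (⟨t, j x t⟩ : Σ t, E t) ∈ V ∧ P i t (v - j x t) < ε := by
  let _ : TopologicalSpace (E t) :=
    ⨅ i, (P i t).toSeminormedAddCommGroup.toUniformSpace.toTopologicalSpace
  have hp := withSeminorms_iInf_toSeminormedAddCommGroup fun i => P i t
  have hmk : Continuous fun w : E t => (⟨t, w⟩ : Σ t, E t) := continuous_iff_le_induced.2 hfibre.ge
  obtain ⟨k, δ, hδ, hkV⟩ := exists_ball_subset_of_directed hp (fun a b =>
    (hdir a b).imp fun c hc => ⟨hc.1 t, hc.2 t⟩) (hmk.continuousAt.preimage_mem_nhds hV)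
  obtain ⟨l, hil, hkl⟩ := hdir i k
  obtain ⟨x, hx⟩ := hdense l t v (min ε δ) (lt_min hε hδ)
  refine ⟨x, hkV ?_, (hil t _).trans_lt (hx.trans_le (min_le_left _ _))⟩
  rw [Seminorm.mem_ball, map_sub_rev]
  exact (hkl t _).trans_lt (hx.trans_le (min_le_right _ _))

variable [TopologicalSpace M]

/-- The collection of all tubes over open sets around the sections `j x`. For the family of jets
these are the sets `W(x, U, p, ε)`. -/
def sectionTubes (P : ι → ∀ t, Seminorm ℂ (E t)) (j : X → ∀ t, E t) : Set (Set (Σ t, E t)) :=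
  {W | ∃ (x : X) (U : Set M) (i : ι) (ε : ℝ), IsOpen U ∧ 0 < ε ∧ W = sectionTube P j x U i ε}

/-- The coarsest topology on the total space for which the projection is continuous and all the
functions `ξ ↦ P i (ξ - j x (π ξ))` are upper semicontinuous. -/
abbrev sectionTopology (P : ι → ∀ t, Seminorm ℂ (E t)) (j : X → ∀ t, E t) :
    TopologicalSpace (Σ t, E t) :=
  induced Sigma.fst inferInstance ⊓
    generateFrom {W | ∃ i x r, W = {ξ | P i ξ.1 (ξ.2 - j x ξ.1) < r}}

theorem continuous_proj_sectionTopology (P : ι → ∀ t, Seminorm ℂ (E t)) (j : X → ∀ t, E t) :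
    Continuous[sectionTopology P j, _] fun ξ : Σ t, E t => ξ.1 :=
  continuous_inf_dom_left continuous_induced_dom

section GivenTopology

variable {P : ι → ∀ t, Seminorm ℂ (E t)} {j : X → ∀ t, E t} {τ : TopologicalSpace (Σ t, E t)}

namespace IsLocallyConvexBundle

theorem continuous_add_fibrewise (h : IsLocallyConvexBundle P τ) {Y : Type*} [TopologicalSpace Y]
    {b : Y → M} {v w : ∀ y, E (b y)} (hv : Continuous fun y => (⟨b y, v y⟩ : Σ t, E t))
    (hw : Continuous fun y => (⟨b y, w y⟩ : Σ t, E t)) :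
    Continuous fun y => (⟨b y, v y + w y⟩ : Σ t, E t) := by
  let _ := fibreProductTopology τ
  have hvw : Continuous fun y => (⟨b y, v y, w y⟩ : Σ t, E t × E t) :=
    continuous_induced_rng.2 (hv.prodMk hw)
  exact Continuous.comp (g := fun z : Σ t, E t × E t => (⟨z.1, z.2.1 + z.2.2⟩ : Σ t, E t))
    h.continuous_add hvw

theorem isOpen_sectionTube (h : IsLocallyConvexBundle P τ) {x : X}
    (hj : Continuous fun t => (⟨t, j x t⟩ : Σ t, E t)) {U : Set M} (hU : IsOpen U) (i : ι)
    (ε : ℝ) : IsOpen (sectionTube P j x U i ε) := by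
  have hneg : Continuous fun t => (⟨t, -j x t⟩ : Σ t, E t) := by
    simpa only [ContinuousMap.const_apply, neg_one_smul] using
      h.continuous_smul_section hj (ContinuousMap.const M (-1))
  have hsub : Continuous fun ξ : Σ t, E t => (⟨ξ.1, ξ.2 - j x ξ.1⟩ : Σ t, E t) := by
    simpa only [sub_eq_add_neg] using
      h.continuous_add_fibrewise continuous_id (hneg.comp h.continuous_proj)
  exact (hU.preimage h.continuous_proj).inter
    (((h.upperSemicontinuous i).isOpen_preimage ε).preimage hsub)

theorem exists_add_mem (h : IsLocallyConvexBundle P τ) {t : M} {v : E t} {V : Set (Σ t, E t)}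
    (hV : V ∈ 𝓝 (⟨t, v⟩ : Σ t, E t)) :
    ∃ i, ∃ ε : ℝ, 0 < ε ∧ ∃ V' ∈ 𝓝 (⟨t, v⟩ : Σ t, E t), ∀ (s : M) (u w : E s),
      P i s u < ε → (⟨s, w⟩ : Σ t, E t) ∈ V' → (⟨s, u + w⟩ : Σ t, E t) ∈ V := by
  let _ := fibreProductTopology τ
  have hadd : (fun z : Σ t, E t × E t => (⟨z.1, z.2.1 + z.2.2⟩ : Σ t, E t)) ⁻¹' V ∈
      𝓝 (⟨t, 0, v⟩ : Σ t, E t × E t) :=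
    h.continuous_add.continuousAt (by simpa only [zero_add] using hV)
  rw [nhds_induced, mem_comap] at hadd
  obtain ⟨N, hN, hNV⟩ := hadd
  obtain ⟨V₀, hV₀, V', hV', hVN⟩ := mem_nhds_prod_iff.1 hN
  obtain ⟨i, ε, hε, U, hU, ht, hUV⟩ := h.nhds_zero t V₀ hV₀
  have hU' : {ξ : Σ t, E t | ξ.1 ∈ U} ∈ 𝓝 (⟨t, v⟩ : Σ t, E t) :=
    (hU.preimage h.continuous_proj).mem_nhds ht
  exact ⟨i, ε, hε, _, inter_mem hU' hV', fun s u w hu hw =>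
    hNV (a := (⟨s, u, w⟩ : Σ t, E t × E t)) (hVN ⟨hUV ⟨hw.1, hu⟩, hw.2⟩)⟩

theorem isTopologicalBasis_sectionTubes [Nonempty ι] (h : IsLocallyConvexBundle P τ)
    (hdir : Directed (· ≤ ·) P) (hdense : FibrewiseDense P j)
    (hj : ∀ x, Continuous fun t => (⟨t, j x t⟩ : Σ t, E t)) :
    IsTopologicalBasis (sectionTubes P j) := by
  refine isTopologicalBasis_of_isOpen_of_nhds ?_ ?_
  · rintro _ ⟨x, U, i, ε, hU, -, rfl⟩
    exact h.isOpen_sectionTube (hj x) hU i ε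
  · rintro ⟨t, v⟩ V hv hV
    obtain ⟨i, ε, hε, V', hV', hadd⟩ := h.exists_add_mem (hV.mem_nhds hv)
    obtain ⟨x, hxV', hx⟩ := exists_section_mem (h.fibre_topology t) hdir hdense
      (interior_mem_nhds.2 hV') i hε
    refine ⟨_, ⟨x, _, i, ε, isOpen_interior.preimage (hj x), hε, rfl⟩, ⟨hxV', hx⟩, ?_⟩
    rintro ⟨s, w⟩ ⟨hs, hw⟩
    simpa only [sub_add_cancel] using hadd s (w - j x s) (j x s) hw (interior_subset hs)

theorem topology_eq [Nonempty ι] {τ' : TopologicalSpace (Σ t, E t)}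
    (h : IsLocallyConvexBundle P τ) (h' : IsLocallyConvexBundle P τ')
    (hdir : Directed (· ≤ ·) P) (hdense : FibrewiseDense P j)
    (hj : ∀ x, Continuous[_, τ] fun t => (⟨t, j x t⟩ : Σ t, E t))
    (hj' : ∀ x, Continuous[_, τ'] fun t => (⟨t, j x t⟩ : Σ t, E t)) : τ = τ' :=
  (@IsTopologicalBasis.eq_generateFrom _ τ _
    (h.isTopologicalBasis_sectionTubes hdir hdense hj)).trans
    (h'.isTopologicalBasis_sectionTubes hdir hdense hj').eq_generateFrom.symm

end IsLocallyConvexBundle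

end GivenTopology

section LinearFamily

variable [AddCommGroup X] [Module ℂ X] {P : ι → ∀ t, Seminorm ℂ (E t)} {j : X →ₗ[ℂ] ∀ t, E t}

theorem eventually_sub_section_lt {i : ι} {x : X} {ξ : Σ t, E t} {r : ℝ}
    (hξ : P i ξ.1 (ξ.2 - j x ξ.1) < r) :
    ∀ᶠ η in @nhds _ (sectionTopology P j) ξ, P i η.1 (η.2 - j x η.1) < r := by
  have hopen : IsOpen[sectionTopology P j] {η | P i η.1 (η.2 - j x η.1) < r} :=
    TopologicalSpace.le_def.1 inf_le_right _ (GenerateOpen.basic _ ⟨i, x, r, rfl⟩)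
  exact @IsOpen.mem_nhds _ (sectionTopology P j) ξ _ hopen hξ

theorem tendsto_nhds_sectionTopology
    (husc : ∀ i x, UpperSemicontinuous fun t => P i t (j x t)) {Y : Type*} {l : Filter Y}
    {f : Y → Σ t, E t} {ξ : Σ t, E t} (hbase : Tendsto (fun y => (f y).1) l (𝓝 ξ.1))
    (happrox : ∀ i, ∀ ε > 0, ∃ z, P i ξ.1 (ξ.2 - j z ξ.1) < ε ∧
      ∀ᶠ y in l, P i (f y).1 ((f y).2 - j z (f y).1) < ε) :
    Tendsto f l (@nhds _ (sectionTopology P j) ξ) := by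
  rw [nhds_inf, nhds_induced, tendsto_inf, tendsto_comap_iff, tendsto_nhds_generateFrom_iff]
  refine ⟨hbase, ?_⟩
  rintro _ ⟨i, x, r, rfl⟩ (hξ : P i ξ.1 (ξ.2 - j x ξ.1) < r)
  obtain ⟨z, hz, hfz⟩ := happrox i ((r - P i ξ.1 (ξ.2 - j x ξ.1)) / 2) (by linarith)
  have hzx : P i ξ.1 (j (z - x) ξ.1) < (r + P i ξ.1 (ξ.2 - j x ξ.1)) / 2 := by
    have := map_sub_le_add (P i ξ.1) (ξ.2 - j x ξ.1) (ξ.2 - j z ξ.1)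
    rw [sub_sub_sub_cancel_left] at this
    simp only [map_sub, Pi.sub_apply]
    linarith
  filter_upwards [hfz, hbase.eventually (husc i (z - x) ξ.1 _ hzx)] with y hy hyzx
  have := map_add_le_add (P i (f y).1) ((f y).2 - j z (f y).1) (j (z - x) (f y).1)
  simp only [map_sub, Pi.sub_apply, sub_add_sub_cancel] at this hyzx
  change P i (f y).1 ((f y).2 - j x (f y).1) < r
  linarith

theorem continuous_section_sectionTopology
    (husc : ∀ i x, UpperSemicontinuous fun t => P i t (j x t)) (x : X) :
    Continuous[_, sectionTopology P j] fun t => (⟨t, j x t⟩ : Σ t, E t) := by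
  let _ := sectionTopology P j
  refine continuous_iff_continuousAt.2 fun t => tendsto_nhds_sectionTopology husc tendsto_id
    fun i ε hε => ⟨x, ?_⟩
  simpa only [sub_self, map_zero] using ⟨hε, .of_forall fun _ => hε⟩

theorem upperSemicontinuous_sectionTopology (P : ι → ∀ t, Seminorm ℂ (E t))
    (j : X →ₗ[ℂ] ∀ t, E t) (i : ι) :
    let _ := sectionTopology P j
    UpperSemicontinuous fun ξ : Σ t, E t => P i ξ.1 ξ.2 := by
  intro _ ξ r hr
  have h0 : ∀ η : Σ t, E t, P i η.1 (η.2 - j 0 η.1) = P i η.1 η.2 := fun η => by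
    rw [map_zero, Pi.zero_apply, sub_zero]
  simpa only [h0] using eventually_sub_section_lt ((h0 ξ).trans_lt hr)

theorem continuous_add_sectionTopology
    (husc : ∀ i x, UpperSemicontinuous fun t => P i t (j x t)) (hdense : FibrewiseDense P j) :
    Continuous[fibreProductTopology (sectionTopology P j), sectionTopology P j]
      fun z => (⟨z.1, z.2.1 + z.2.2⟩ : Σ t, E t) := by
  let _ := sectionTopology P j
  let _ := fibreProductTopology (sectionTopology P j)
  have hpair : Continuous fun z : Σ t, E t × E t =>
      ((⟨z.1, z.2.1⟩, ⟨z.1, z.2.2⟩) : (Σ t, E t) × (Σ t, E t)) := continuous_induced_dom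
  refine continuous_iff_continuousAt.2 fun ⟨t, v, w⟩ => tendsto_nhds_sectionTopology husc
    (((continuous_proj_sectionTopology P j).comp hpair.fst).tendsto _) fun i ε hε => ?_
  obtain ⟨x, hx⟩ := hdense i t v (ε / 2) (half_pos hε)
  obtain ⟨y, hy⟩ := hdense i t w (ε / 2) (half_pos hε)
  have key : ∀ (s : M) (v w : E s), P i s (v - j x s) < ε / 2 → P i s (w - j y s) < ε / 2 →
      P i s (v + w - j (x + y) s) < ε := fun s v w hv hw => by
    rw [map_add, Pi.add_apply, add_sub_add_comm]
    linarith [map_add_le_add (P i s) (v - j x s) (w - j y s)]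
  refine ⟨x + y, key t v w hx hy, ?_⟩
  filter_upwards [(hpair.fst.tendsto _).eventually (eventually_sub_section_lt hx),
    (hpair.snd.tendsto _).eventually (eventually_sub_section_lt hy)] with z hv hw
  exact key z.1 z.2.1 z.2.2 hv hw

theorem continuous_smul_sectionTopology
    (husc : ∀ i x, UpperSemicontinuous fun t => P i t (j x t)) (hdense : FibrewiseDense P j) :
    let _ := sectionTopology P j
    Continuous fun z : ℂ × (Σ t, E t) => (⟨z.2.1, z.1 • z.2.2⟩ : Σ t, E t) := by
  intro _
  have hproj : Continuous fun z : ℂ × (Σ t, E t) => z.2.1 :=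
    (continuous_proj_sectionTopology P j).comp continuous_snd
  refine continuous_iff_continuousAt.2 fun ⟨c, t, v⟩ => tendsto_nhds_sectionTopology husc
    (hproj.tendsto _) fun i ε hε => ?_
  have hc : 0 < ‖c‖ + 1 := by positivity
  obtain ⟨x, hx⟩ := hdense i t v (ε / 2 / (‖c‖ + 1)) (by positivity)
  have hdiff : Tendsto (fun z : ℂ × (Σ t, E t) => ‖z.1 - c‖ * (P i t (j x t) + 1))
      (𝓝 (c, ⟨t, v⟩)) (𝓝 0) := by
    have : Continuous fun z : ℂ × (Σ t, E t) => ‖z.1 - c‖ * (P i t (j x t) + 1) := by fun_prop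
    simpa using this.tendsto (c, ⟨t, v⟩)
  have key : ∀ (a : ℂ) (s : M) (w : E s), ‖a‖ < ‖c‖ + 1 →
      P i s (w - j x s) < ε / 2 / (‖c‖ + 1) → P i s (j x s) < P i t (j x t) + 1 →
      ‖a - c‖ * (P i t (j x t) + 1) < ε / 2 → P i s (a • w - j (c • x) s) < ε :=
    fun a s w ha hw hxs hac => calc P i s (a • w - j (c • x) s)
      _ ≤ ‖a‖ * P i s (w - j x s) + ‖a - c‖ * P i s (j x s) := by
        rw [map_smul, Pi.smul_apply]
        exact seminorm_smul_sub_smul_le (P i s) a c w (j x s)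
      _ ≤ (‖c‖ + 1) * (ε / 2 / (‖c‖ + 1)) + ‖a - c‖ * (P i t (j x t) + 1) := by gcongr
      _ = ε / 2 + ‖a - c‖ * (P i t (j x t) + 1) := by rw [mul_div_cancel₀ _ hc.ne']
      _ < ε := by linarith
  refine ⟨c • x, key c t v (lt_add_one _) hx (lt_add_one _) (by simpa using hε), ?_⟩
  have hnorm : Continuous fun z : ℂ × (Σ t, E t) => ‖z.1‖ := by fun_prop
  filter_upwards [(hnorm.tendsto (c, ⟨t, v⟩)).eventually_lt_const (lt_add_one ‖c‖),
    (continuous_snd.tendsto (c, ⟨t, v⟩)).eventually (eventually_sub_section_lt hx),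
    (hproj.tendsto (c, ⟨t, v⟩)).eventually (husc i x t _ (lt_add_one _)),
    hdiff.eventually_lt_const (half_pos hε)] with z h₁ h₂ h₃ h₄
  exact key z.1 z.2.1 z.2.2 h₁ h₂ h₃ h₄

theorem induced_sectionTopology (husc : ∀ i x, UpperSemicontinuous fun t => P i t (j x t))
    (hdense : FibrewiseDense P j) (t : M) :
    induced (fun v : E t => (⟨t, v⟩ : Σ t, E t)) (sectionTopology P j) =
      ⨅ i, (P i t).toSeminormedAddCommGroup.toUniformSpace.toTopologicalSpace := by
  let _ := ⨅ i, (P i t).toSeminormedAddCommGroup.toUniformSpace.toTopologicalSpace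
  have hp := withSeminorms_iInf_toSeminormedAddCommGroup fun i => P i t
  refine TopologicalSpace.ext_nhds fun v => ?_
  rw [@nhds_induced _ _ (sectionTopology P j)]
  refine le_antisymm (tendsto_id'.1 ((hp.tendsto_nhds id v).2 fun i ε hε => ?_))
    (tendsto_iff_comap.1 (tendsto_nhds_sectionTopology husc tendsto_const_nhds fun i ε hε => ?_))
  · obtain ⟨x, hx⟩ := hdense i t v (ε / 2) (half_pos hε)
    filter_upwards [tendsto_comap.eventually (eventually_sub_section_lt (ξ := ⟨t, v⟩) hx)] with w hw
    have := map_sub_le_add (P i t) (w - j x t) (v - j x t)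
    rw [sub_sub_sub_cancel_right] at this
    exact this.trans_lt (by linarith)
  · obtain ⟨x, hx⟩ := hdense i t v ε hε
    have hcont : Continuous fun w => P i t (w - j x t) := by
      have := hp.topologicalAddGroup
      exact (hp.continuous_seminorm i).comp (continuous_id.sub continuous_const)
    exact ⟨x, hx, (hcont.tendsto v).eventually_lt_const hx⟩

theorem nhds_zero_sectionTopology [Nonempty ι] (hdir : Directed (· ≤ ·) P)
    (husc : ∀ i x, UpperSemicontinuous fun t => P i t (j x t)) {t : M} {V : Set (Σ t, E t)}
    (hV : V ∈ @nhds _ (sectionTopology P j) ⟨t, 0⟩) :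
    ∃ i, ∃ ε : ℝ, 0 < ε ∧ ∃ U : Set M, IsOpen U ∧ t ∈ U ∧
      {ξ : Σ t, E t | ξ.1 ∈ U ∧ P i ξ.1 ξ.2 < ε} ⊆ V := by
  let l : ι → Filter (Σ t, E t) := fun i =>
    comap Sigma.fst (𝓝 t) ⊓ comap (fun ξ => P i ξ.1 ξ.2) (𝓝 0)
  have hVl : V ∈ ⨅ i, l i := by
    refine tendsto_nhds_sectionTopology (f := id) husc ?_ (fun i ε hε => ⟨0, ?_⟩) hV
    · exact tendsto_iInf' (Classical.arbitrary ι) (tendsto_comap.mono_left inf_le_left)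
    · have hsmall : ∀ᶠ ξ in ⨅ i, l i, P i ξ.1 ξ.2 < ε :=
        (tendsto_iInf' i (tendsto_comap.mono_left inf_le_right)).eventually_lt_const hε
      simpa only [map_zero, Pi.zero_apply, sub_zero] using! ⟨hε, hsmall⟩
  have hdirl : Directed (· ≥ ·) l := fun a b => (hdir a b).imp fun c hc => by
    have hle : ∀ k, P k ≤ P c → l c ≤ l k := fun k hk =>
      inf_le_inf_left _ (tendsto_iff_comap.1 (squeeze_zero (fun _ => apply_nonneg _ _)
        (fun ξ => hk ξ.1 ξ.2) tendsto_comap))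
    exact ⟨hle a hc.1, hle b hc.2⟩
  obtain ⟨i, hi⟩ := (mem_iInf_of_directed hdirl V).1 hVl
  obtain ⟨⟨U, ε⟩, ⟨⟨ht, hU⟩, hε⟩, hUV⟩ := (((nhds_basis_opens t).comap _).inf
    ((nhds_basis_zero_abs_lt ℝ).comap _)).mem_iff.1 hi
  exact ⟨i, ε, hε, U, hU, ht, fun ξ hξ =>
    hUV ⟨hξ.1, (abs_of_nonneg (apply_nonneg _ _)).trans_lt hξ.2⟩⟩

theorem isOpenMap_proj_sectionTopology [Nonempty ι] (hdir : Directed (· ≤ ·) P)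
    (husc : ∀ i x, UpperSemicontinuous fun t => P i t (j x t)) (hdense : FibrewiseDense P j) :
    let _ := sectionTopology P j
    IsOpenMap fun ξ : Σ t, E t => ξ.1 := by
  intro _
  refine IsOpenMap.of_nhds_le fun ⟨t, v⟩ S hS => ?_
  obtain ⟨x, hx, -⟩ := exists_section_mem (induced_sectionTopology husc hdense t) hdir hdense
    (eventually_eventually_nhds.2 hS) (Classical.arbitrary ι) one_pos
  exact (continuous_section_sectionTopology husc x).continuousAt.eventually hx

theorem isLocallyConvexBundle_sectionTopology [Nonempty ι] (hdir : Directed (· ≤ ·) P)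
    (hsep : ∀ t (v : E t), (∀ i, P i t v = 0) → v = 0)
    (husc : ∀ i x, UpperSemicontinuous fun t => P i t (j x t)) (hdense : FibrewiseDense P j) :
    IsLocallyConvexBundle P (sectionTopology P j) :=
  let _ := sectionTopology P j
  { continuous_proj := continuous_proj_sectionTopology P j
    isOpenMap_proj := isOpenMap_proj_sectionTopology hdir husc hdense
    separating := hsep
    fibre_topology := induced_sectionTopology husc hdense
    continuous_smul := continuous_smul_sectionTopology husc hdense
    continuous_add := continuous_add_sectionTopology husc hdense
    upperSemicontinuous := upperSemicontinuous_sectionTopology P j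
    nhds_zero := fun _ _ => nhds_zero_sectionTopology hdir husc }

end LinearFamily

end SectionTopology

namespace IsLocallyConvexBundle

variable {M : Type*} [TopologicalSpace M] {E : M → Type*} [∀ t, AddCommGroup (E t)]
  [∀ t, Module ℂ (E t)] {ι : Type*} {P : ι → ∀ t, Seminorm ℂ (E t)}
  {τ : TopologicalSpace (Σ t, E t)}

theorem le_secSeminorm (h : IsLocallyConvexBundle P τ) (i : ι) {T : Compacts M} (s : h.Sec)
    {t : M} (ht : t ∈ T) : P i t (s.1 t) ≤ h.secSeminorm i T s :=
  le_ciSup (h.bddAbove_sec i T s) ⟨t, ht⟩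

theorem secSeminorm_le (h : IsLocallyConvexBundle P τ) {i : ι} {T : Compacts M} {s : h.Sec}
    {r : ℝ} (hr : 0 ≤ r) (hs : ∀ t ∈ T, P i t (s.1 t) ≤ r) : h.secSeminorm i T s ≤ r :=
  Real.iSup_le (fun t => hs t t.2) hr

theorem secSeminorm_smul_le (h : IsLocallyConvexBundle P τ) (i : ι) (T : Compacts M)
    (f : C(M, ℂ)) (s : h.Sec) :
    h.secSeminorm i T (f • s) ≤ ‖f.restrict (T : Set M)‖ * h.secSeminorm i T s := by
  refine h.secSeminorm_le (by positivity) fun t ht => ?_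
  calc P i t (f t • s.1 t)
    _ = ‖f.restrict (T : Set M) ⟨t, ht⟩‖ * P i t (s.1 t) := map_smul_eq_mul _ _ _
    _ ≤ ‖f.restrict (T : Set M)‖ * h.secSeminorm i T s := by
      gcongr
      exacts [ContinuousMap.norm_coe_le_norm _ _, h.le_secSeminorm i s ht]

theorem withSeminorms_sec (h : IsLocallyConvexBundle P τ) :
    WithSeminorms fun k : ι × Compacts M => h.secSeminorm k.1 k.2 := by
  convert withSeminorms_iInf_toSeminormedAddCommGroup
    fun k : ι × Compacts M => h.secSeminorm k.1 k.2 using 1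
  rw [iInf_prod]
  rfl

theorem continuous_of_le (h : IsLocallyConvexBundle P τ) {X : Type*} [AddCommGroup X]
    [Module ℂ X] [TopologicalSpace X] [IsTopologicalAddGroup X]
    (f : X →ₗ[ℂ] h.Sec) (p : ι → Seminorm ℂ X) (hp : ∀ i, Continuous (p i))
    (hf : ∀ i x t, P i t ((f x).1 t) ≤ p i x) : Continuous f :=
  WithSeminorms.continuous_of_continuous_comp h.withSeminorms_sec f fun k =>
    Seminorm.continuous_of_le (hp k.1) fun x =>
      h.secSeminorm_le (apply_nonneg _ _) fun t _ => hf k.1 x t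

instance continuousSMul_sec (h : IsLocallyConvexBundle P τ) : ContinuousSMul C(M, ℂ) h.Sec where
  continuous_smul := by
    have hw := h.withSeminorms_sec
    have := hw.topologicalAddGroup
    refine continuous_iff_continuousAt.2 fun ⟨f₀, s₀⟩ => (hw.tendsto_nhds _ _).2 ?_
    rintro ⟨i, T⟩ ε hε
    let q := h.secSeminorm i T
    have hq : Continuous q := hw.continuous_seminorm (i, T)
    have hres : Continuous fun f : C(M, ℂ) => f.restrict (T : Set M) :=
      ContinuousMap.continuous_restrict _
    have h0 : (0 : C(M, ℂ)).restrict (T : Set M) = 0 := rfl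
    have hbound : Continuous fun z : C(M, ℂ) × h.Sec => ‖z.1.restrict (T : Set M)‖ * q (z.2 - s₀) +
        ‖(z.1 - f₀).restrict (T : Set M)‖ * q s₀ := by
      fun_prop
    have hlt := (hbound.tendsto (f₀, s₀)).eventually_lt_const (u := ε) <| by
      simpa only [sub_self, map_zero, mul_zero, zero_add, h0, norm_zero, zero_mul] using hε
    filter_upwards [hlt] with z hz
    have hsplit : z.1 • z.2 - f₀ • s₀ = z.1 • (z.2 - s₀) + (z.1 - f₀) • s₀ := by
      rw [smul_sub, sub_smul]; abel
    calc q (z.1 • z.2 - f₀ • s₀)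
      _ ≤ q (z.1 • (z.2 - s₀)) + q ((z.1 - f₀) • s₀) := hsplit ▸ map_add_le_add q _ _
      _ ≤ ‖z.1.restrict (T : Set M)‖ * q (z.2 - s₀) +
          ‖(z.1 - f₀).restrict (T : Set M)‖ * q s₀ :=
        add_le_add (h.secSeminorm_smul_le i T _ _) (h.secSeminorm_smul_le i T _ _)
      _ < ε := hz

end IsLocallyConvexBundle

section Spectrum

variable {A : Type*} [Ring A] [Algebra ℂ A] [UniformSpace A] [StarRing A]

theorem continuous_spectrumHom
    (hA : Continuous (stereotypeBidualMap : A → StereotypeDual (StereotypeDual A))) :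
    Continuous (spectrumHom A) := by
  refine continuous_iff_continuousAt.2 fun a =>
    ContinuousMap.tendsto_iff_forall_isCompact_tendstoUniformlyOn.2 fun T hT => ?_
  have hT' : TotallyBounded (Subtype.val '' T : Set (StereotypeDual A)) :=
    (hT.image continuous_subtype_val).totallyBounded
  have hlim := (UniformConvergenceCLM.tendsto_iff_tendstoUniformlyOn _ _ _).1 (hA.tendsto a) _ hT'
  exact fun u hu => (hlim u hu).mono fun b hb t ht => hb t.1 ⟨t, ht, rfl⟩

end Spectrum

section Stereotype

open scoped ComplexOrder

variable {X : Type*} [AddCommGroup X] [Module ℂ X] [UniformSpace X] [IsUniformAddGroup X]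
  [ContinuousSMul ℂ X]

theorem IsStereotype.polynormableSpace (h : IsStereotype X) : PolynormableSpace ℂ X := by
  have hℂ : LocallyConvexSpace ℂ ℂ :=
    ⟨by simpa only [convex_RCLike_iff_convex_real] using LocallyConvexSpace.convex_basis (𝕜 := ℝ)⟩
  have hbidual : LocallyConvexSpace ℂ (StereotypeDual (StereotypeDual X)) :=
    UniformConvergenceCLM.locallyConvexSpace ℂ _ ⟨∅, totallyBounded_empty⟩
      fun S hS S' hS' => ⟨S ∪ S', hS.union hS', Set.subset_union_left, Set.subset_union_right⟩
  let f : X →ₗ[ℂ] StereotypeDual (StereotypeDual X) :=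
    { toFun := stereotypeBidualMap
      map_add' := fun x y => ContinuousLinearMap.ext fun φ => map_add φ x y
      map_smul' := fun c x => ContinuousLinearMap.ext fun φ => map_smul φ c x }
  have : LocallyConvexSpace ℂ X := IsInducing.locallyConvexSpace (f := f) h.isInducing
  have : ContinuousSMul ℝ X := IsScalarTower.continuousSMul ℂ
  infer_instance

theorem IsStereotypeModule.continuousConstSMul {A : Type*} [Ring A] [UniformSpace A] [Module A X]
    (h : IsStereotypeModule A X) :
    ContinuousConstSMul A X where
  continuous_const_smul a := by
    refine continuous_of_continuousAt_zero (DistribSMul.toAddMonoidHom X a) fun U hU => ?_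
    obtain ⟨V, hV, hVU⟩ := h.smul.1 {a} (Set.finite_singleton a).totallyBounded U
      (by simpa only [map_zero] using hU)
    exact mem_map.2 (mem_of_superset hV fun x hx => hVU a rfl x hx)

end Stereotype

section Quotient

variable {X : Type*} [AddCommGroup X] [Module ℂ X]

theorem quotientSeminorm_mkQ_lt_iff {p : Seminorm ℂ X} {N : Submodule ℂ X} {x : X} {r : ℝ} :
    quotientSeminorm p N (N.mkQ x) < r ↔ ∃ y ∈ N, p (x + y) < r := by
  have hbdd : BddBelow (Set.range fun y : N => p (x + y)) :=
    ⟨0, Set.forall_mem_range.2 fun _ => apply_nonneg p _⟩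
  rw [quotientSeminorm_mk, ciInf_lt_iff hbdd]
  exact Subtype.exists.trans (by simp only [exists_prop])

theorem quotientSeminorm_mkQ_le (p : Seminorm ℂ X) (N : Submodule ℂ X) (x : X) :
    quotientSeminorm p N (N.mkQ x) ≤ p x :=
  le_of_forall_gt fun _ hr => quotientSeminorm_mkQ_lt_iff.2 ⟨0, N.zero_mem, by rwa [add_zero]⟩

theorem quotientSeminorm_mono {p q : Seminorm ℂ X} (hpq : p ≤ q) (N : Submodule ℂ X) :
    quotientSeminorm p N ≤ quotientSeminorm q N := fun v => by
  obtain ⟨x, rfl⟩ := N.mkQ_surjective v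
  refine le_of_forall_gt fun r hr => ?_
  obtain ⟨y, hy, hxy⟩ := quotientSeminorm_mkQ_lt_iff.1 hr
  exact quotientSeminorm_mkQ_lt_iff.2 ⟨y, hy, (hpq _).trans_lt hxy⟩

variable [UniformSpace X] [IsUniformAddGroup X] [ContinuousSMul ℂ X]

theorem withSeminorms_quotientSeminorm [PolynormableSpace ℂ X] (N : Submodule ℂ X) :
    WithSeminorms fun p : {p : Seminorm ℂ X // Continuous p} => quotientSeminorm p.1 N := by
  refine (SeminormFamily.withSeminorms_iff_nhds_eq_iInf _).2 (le_antisymm ?_ fun U hU => ?_)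
  · exact le_iInf fun p => tendsto_iff_comap.1
      ((continuous_quotientSeminorm p.1 p.2 N).tendsto' _ _ (map_zero _))
  · have hU' : N.mkQ ⁻¹' U ∈ 𝓝 (0 : X) :=
      N.isQuotientMap_mkQ.continuous.continuousAt (by rwa [map_zero])
    have : Nonempty {p : Seminorm ℂ X // Continuous p} := ⟨⟨0, continuous_const⟩⟩
    obtain ⟨p, ε, hε, hball⟩ := exists_ball_subset_of_directed (PolynormableSpace.withSeminorms ℂ X)
      (directed_continuousSeminorms ℂ X) hU'
    refine mem_iInf_of_mem p (mem_of_superset (preimage_mem_comap (Iio_mem_nhds hε)) fun v hv => ?_)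
    obtain ⟨x, rfl⟩ := N.mkQ_surjective v
    obtain ⟨y, hy, hxy⟩ := quotientSeminorm_mkQ_lt_iff.1 hv
    have hmem : N.mkQ (x + y) ∈ U := hball (by rwa [Seminorm.mem_ball_zero])
    rwa [map_add, show N.mkQ y = 0 from (Submodule.Quotient.mk_eq_zero N).2 hy, add_zero] at hmem

end Quotient

section Selections

variable {M X : Type*} [TopologicalSpace M] [AddCommGroup X] [Module ℂ X] [TopologicalSpace X]
  [IsTopologicalAddGroup X] [ContinuousConstSMul ℂ X] {N : M → Submodule ℂ X}

/-- The continuous selections of a family of subspaces `N t`. When their values at each `t` are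
dense in `N t`, the family `N` is lower semicontinuous as a set-valued map. -/
def continuousSelections (N : M → Submodule ℂ X) : Submodule ℂ C(M, X) where
  carrier := {f | ∀ t, f t ∈ N t}
  add_mem' hf hg t := add_mem (hf t) (hg t)
  zero_mem' t := zero_mem (N t)
  smul_mem' c _ hf t := (N t).smul_mem c (hf t)

theorem upperSemicontinuous_quotientSeminorm_mkQ
    (hN : ∀ t, N t ≤
      ((continuousSelections N).map (ContinuousMap.evalCLM ℂ t).toLinearMap).topologicalClosure)
    {p : Seminorm ℂ X} (hp : Continuous p) (x : X) :
    UpperSemicontinuous fun t => quotientSeminorm p (N t) ((N t).mkQ x) := by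
  intro t r hr
  obtain ⟨y, hy, hxy⟩ := quotientSeminorm_mkQ_lt_iff.1 hr
  have hopen : IsOpen {y | p (x + y) < r} :=
    isOpen_lt (hp.comp (continuous_const.add continuous_id)) continuous_const
  obtain ⟨_, hfr, f, hf, rfl⟩ := mem_closure_iff.1 (hN t hy) _ hopen hxy
  filter_upwards [(hopen.preimage f.continuous).mem_nhds hfr] with s hs
  exact quotientSeminorm_mkQ_lt_iff.2 ⟨f s, hf s, hs⟩

end Selections

section Completion

variable {E : Type*} [AddCommGroup E] [Module ℂ E] [UniformSpace E] [IsUniformAddGroup E]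
  [UniformContinuousConstSMul ℂ E]

theorem completionSeminorm_coe (p : Seminorm ℂ E) (hp : Continuous p) (x : E) :
    completionSeminorm p hp x = p x :=
  UniformSpace.Completion.extension_coe (p.uniformContinuous_aux hp) x

theorem continuous_completionSeminorm (p : Seminorm ℂ E) (hp : Continuous p) :
    Continuous (completionSeminorm p hp) :=
  UniformSpace.Completion.continuous_extension

theorem completionSeminorm_mono {p q : Seminorm ℂ E} (hp : Continuous p) (hq : Continuous q)
    (hpq : p ≤ q) : completionSeminorm p hp ≤ completionSeminorm q hq := fun v => by
  refine UniformSpace.Completion.induction_on v (isClosed_le (continuous_completionSeminorm p hp)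
    (continuous_completionSeminorm q hq)) fun x => ?_
  rw [completionSeminorm_coe, completionSeminorm_coe]
  exact hpq x

theorem exists_completionSeminorm_sub_coe_lt (p : Seminorm ℂ E) (hp : Continuous p)
    (v : UniformSpace.Completion E) {ε : ℝ} (hε : 0 < ε) :
    ∃ x : E, completionSeminorm p hp (v - x) < ε :=
  UniformSpace.Completion.denseRange_coe.exists_mem_open
    (isOpen_lt ((continuous_completionSeminorm p hp).comp (continuous_const.sub continuous_id))
      continuous_const) ⟨v, by simpa using hε⟩

theorem eq_zero_of_completionSeminorm_eq_zero {ι : Type*} {p : SeminormFamily ℂ E ι}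
    (hp : WithSeminorms p) {v : UniformSpace.Completion E}
    (hv : ∀ i, completionSeminorm (p i) (hp.continuous_seminorm i) v = 0) : v = 0 := by
  let l : Filter E := comap (↑) (𝓝 v)
  have hlv : Tendsto (↑) l (𝓝 v) := tendsto_comap
  have : l.NeBot := UniformSpace.Completion.isDenseInducing_coe.comap_nhds_neBot v
  have hl0 : Tendsto id l (𝓝 0) := (hp.tendsto_nhds id 0).2 fun i ε hε => by
    have hi := ((continuous_completionSeminorm _ (hp.continuous_seminorm i)).tendsto v).comp hlv
    rw [hv] at hi
    simpa only [id, sub_zero, Function.comp_apply, completionSeminorm_coe] using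
      hi.eventually_lt_const hε
  exact tendsto_nhds_unique hlv
    (((UniformSpace.Completion.continuous_coe E).tendsto' 0 0 rfl).comp hl0)

end Completion

section IdealPowers

variable {A : Type*} [Ring A] [Algebra ℂ A] [UniformSpace A] [StarRing A]
variable {X : Type*} [AddCommGroup X] [Module ℂ X] [Module A X] [UniformSpace X]
  [IsUniformAddGroup X] [ContinuousSMul ℂ X]

theorem InvolutiveSpectrum.sub_smul_one_mem_ideal (t : InvolutiveSpectrum A) (a : A) :
    a - t.1 a • (1 : A) ∈ t.ideal := by
  change t.1 (a - t.1 a • (1 : A)) = 0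
  rw [map_sub, map_smul, t.2.1, smul_eq_mul, mul_one, sub_self]

variable (A X) in
/-- The selections `t ↦ g t ∈ I_t ^ m` of the `m`-th powers of the ideals `I_t` that act strongly
continuously on `X`, that is, for which all the orbit maps `t ↦ g t • x` are continuous. -/
def idealPowSelections [IsScalarTower ℂ A X] (m : ℕ) : Submodule ℂ (InvolutiveSpectrum A → A) where
  carrier := {g | (∀ t, g t ∈ t.ideal ^ m) ∧ ∀ x : X, Continuous fun t => g t • x}
  add_mem' hf hg := ⟨fun t => add_mem (hf.1 t) (hg.1 t), fun x =>
    ((hf.2 x).add (hg.2 x)).congr fun _ => (add_smul _ _ x).symm⟩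
  zero_mem' := ⟨fun t => zero_mem _, fun x => by
    simpa only [Pi.zero_apply, zero_smul] using continuous_const⟩
  smul_mem' c _ hf := ⟨fun t => Submodule.smul_mem _ c (hf.1 t), fun x =>
    ((hf.2 x).const_smul c).congr fun _ => (smul_assoc c _ x).symm⟩

variable [IsScalarTower ℂ A X] [ContinuousConstSMul A X]

theorem sub_smul_one_mul_mem_idealPowSelections {m : ℕ} {g : InvolutiveSpectrum A → A}
    (hg : g ∈ idealPowSelections A X m) (b : A) :
    (fun t => (b - t.1 b • (1 : A)) * g t) ∈ idealPowSelections A X (m + 1) := by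
  refine ⟨fun t => ?_, fun x => ?_⟩
  · rw [pow_succ']
    exact Submodule.mul_mem_mul (t.sub_smul_one_mem_ideal b) (hg.1 t)
  · have hcont := ((hg.2 x).const_smul b).sub ((spectrumHom A b).continuous.smul (hg.2 x))
    refine hcont.congr fun t => ?_
    rw [mul_smul, sub_smul, smul_assoc, one_smul]
    rfl

variable (X) in
theorem ideal_pow_le_map_idealPowSelections (t : InvolutiveSpectrum A) (m : ℕ) :
    t.ideal ^ m ≤ (idealPowSelections A X m).map (LinearMap.proj t) := by
  induction m with
  | zero =>
    rw [pow_zero, Submodule.one_le]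
    exact ⟨1, ⟨fun s => by rw [pow_zero]; exact Submodule.one_le.1 le_rfl, fun x => by
      simpa only [Pi.one_apply] using continuous_const⟩, rfl⟩
  | succ m ih =>
    rw [pow_succ', Submodule.mul_le]
    intro b (hb : t.1 b = 0) a ha
    obtain ⟨g, hg, rfl⟩ := ih ha
    refine ⟨_, sub_smul_one_mul_mem_idealPowSelections hg b, ?_⟩
    simp only [LinearMap.proj_apply, hb, zero_smul, sub_zero]

variable (X) in
theorem jetSubmodule_le_closure_continuousSelections (n : ℕ) (t : InvolutiveSpectrum A) :
    jetSubmodule X n t ≤ ((continuousSelections (jetSubmodule X n)).map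
      (ContinuousMap.evalCLM ℂ t).toLinearMap).topologicalClosure := by
  refine Submodule.topologicalClosure_mono (Submodule.span_le.2 ?_)
  rintro _ ⟨a, ha, x, rfl⟩
  obtain ⟨g, hg, rfl⟩ := ideal_pow_le_map_idealPowSelections X t (n + 1) ha
  exact ⟨⟨fun s => g s • x, hg.2 x⟩, fun s =>
    Submodule.le_topologicalClosure _ (Submodule.subset_span ⟨g s, hg.1 s, x, rfl⟩), rfl⟩

end IdealPowers

section Jets

variable {A : Type*} [Ring A] [Algebra ℂ A] [UniformSpace A] [StarRing A]
variable {X : Type*} [AddCommGroup X] [Module ℂ X] [Module A X] [UniformSpace X]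
  [IsUniformAddGroup X] [ContinuousSMul ℂ X]

variable (A X) in
/-- The map `j^n` as a linear map from `X` to the families of jets. -/
noncomputable def jetLinearMap (n : ℕ) : X →ₗ[ℂ] ∀ t : InvolutiveSpectrum A, Jet X n t :=
  LinearMap.pi fun t => (toPseudocompletion _).comp (jetSubmodule X n t).mkQ

theorem jetSeminorm_jet (n : ℕ) (p : {p : Seminorm ℂ X // Continuous p})
    (t : InvolutiveSpectrum A) (x : X) :
    jetSeminorm X n p t (jet n x t) =
      quotientSeminorm p.1 (jetSubmodule X n t) ((jetSubmodule X n t).mkQ x) :=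
  completionSeminorm_coe _ (continuous_quotientSeminorm p.1 p.2 _) _

theorem jetSeminorm_jet_le (n : ℕ) (p : {p : Seminorm ℂ X // Continuous p})
    (t : InvolutiveSpectrum A) (x : X) : jetSeminorm X n p t (jet n x t) ≤ p.1 x :=
  (jetSeminorm_jet n p t x).trans_le (quotientSeminorm_mkQ_le p.1 _ x)

theorem jetSeminorm_mono {p q : {p : Seminorm ℂ X // Continuous p}} (hpq : p ≤ q) (n : ℕ)
    (t : InvolutiveSpectrum A) : jetSeminorm X n p t ≤ jetSeminorm X n q t := fun v =>
  completionSeminorm_mono (continuous_quotientSeminorm p.1 p.2 _)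
    (continuous_quotientSeminorm q.1 q.2 _) (quotientSeminorm_mono hpq _) v.1

variable (A X) in
theorem directed_jetSeminorm (n : ℕ) :
    Directed (· ≤ ·) fun (p : {p : Seminorm ℂ X // Continuous p}) (t : InvolutiveSpectrum A) =>
      jetSeminorm X n p t := fun p q =>
  (directed_continuousSeminorms ℂ X p q).imp fun _ hr =>
    ⟨fun t => jetSeminorm_mono hr.1 n t, fun t => jetSeminorm_mono hr.2 n t⟩

variable (A X) in
theorem fibrewiseDense_jetLinearMap (n : ℕ) :
    FibrewiseDense (fun (p : {p : Seminorm ℂ X // Continuous p}) (t : InvolutiveSpectrum A) =>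
      jetSeminorm X n p t) (jetLinearMap A X n) := fun p t v ε hε => by
  obtain ⟨q, hq⟩ := exists_completionSeminorm_sub_coe_lt _
    (continuous_quotientSeminorm p.1 p.2 (jetSubmodule X n t)) v.1 hε
  obtain ⟨x, rfl⟩ := (jetSubmodule X n t).mkQ_surjective q
  exact ⟨x, hq⟩

theorem eq_zero_of_jetSeminorm_eq_zero [PolynormableSpace ℂ X] {n : ℕ} {t : InvolutiveSpectrum A}
    {v : Jet X n t} (hv : ∀ p, jetSeminorm X n p t v = 0) : v = 0 :=
  Subtype.ext (eq_zero_of_completionSeminorm_eq_zero (withSeminorms_quotientSeminorm _) hv)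

theorem upperSemicontinuous_jetSeminorm_jet [IsScalarTower ℂ A X] [ContinuousConstSMul A X]
    (n : ℕ) (p : {p : Seminorm ℂ X // Continuous p}) (x : X) :
    UpperSemicontinuous fun t : InvolutiveSpectrum A => jetSeminorm X n p t (jet n x t) := by
  simpa only [jetSeminorm_jet] using upperSemicontinuous_quotientSeminorm_mkQ
    (jetSubmodule_le_closure_continuousSelections X n) p.2 x

end Jets

theorem mainTheorem7_general
    {A : Type*} [Ring A] [Algebra ℂ A] [UniformSpace A] [StarRing A]
    (hA : Continuous (stereotypeBidualMap : A → StereotypeDual (StereotypeDual A)))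
    {X : Type*} [AddCommGroup X] [Module ℂ X] [Module A X] [IsScalarTower ℂ A X]
    [UniformSpace X] [IsUniformAddGroup X] [ContinuousSMul ℂ X] [ContinuousConstSMul A X]
    [PolynormableSpace ℂ X] (n : ℕ) :
    ∃ τ : TopologicalSpace (Σ t : InvolutiveSpectrum A, Jet X n t),
      ∃ h : IsLocallyConvexBundle
          (fun (p : {p : Seminorm ℂ X // Continuous p}) (t : InvolutiveSpectrum A) =>
            jetSeminorm X n p t) τ,
      ∃ hj : ∀ x : X, (fun t : InvolutiveSpectrum A => jet n x t) ∈ h.Sec,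
        Continuous (fun x : X => (⟨fun t => jet n x t, hj x⟩ : h.Sec)) ∧
        Continuous (fun z : A × h.Sec => spectrumHom A z.1 • z.2) ∧
        @TopologicalSpace.IsTopologicalBasis _ τ
          {W | ∃ (x : X) (U : Set (InvolutiveSpectrum A))
            (p : {p : Seminorm ℂ X // Continuous p}) (ε : ℝ),
            IsOpen U ∧ 0 < ε ∧ W = jetBasicSet n x U p ε} ∧
        ∀ τ' : TopologicalSpace (Σ t : InvolutiveSpectrum A, Jet X n t),
          IsLocallyConvexBundle
            (fun (p : {p : Seminorm ℂ X // Continuous p}) (t : InvolutiveSpectrum A) =>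
              jetSeminorm X n p t) τ' →
          (∀ x : X, Continuous[_, τ'] fun t : InvolutiveSpectrum A =>
            (⟨t, jet n x t⟩ : Σ t : InvolutiveSpectrum A, Jet X n t)) →
          τ' = τ := by
  have : Nonempty {p : Seminorm ℂ X // Continuous p} := ⟨⟨0, continuous_const⟩⟩
  have hdir := directed_jetSeminorm A X n
  have hdense := fibrewiseDense_jetLinearMap A X n
  have husc := upperSemicontinuous_jetSeminorm_jet (A := A) (X := X) n
  have h := isLocallyConvexBundle_sectionTopology (j := jetLinearMap A X n) hdir
    (fun _ _ => eq_zero_of_jetSeminorm_eq_zero) husc hdense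
  have hj : ∀ x, jetLinearMap A X n x ∈ h.Sec := continuous_section_sectionTopology husc
  refine ⟨_, h, hj, ?_, ?_, h.isTopologicalBasis_sectionTubes hdir hdense hj,
    fun τ' h' hj' => h'.topology_eq h hdir hdense hj' hj⟩
  · exact h.continuous_of_le ((jetLinearMap A X n).codRestrict h.Sec hj) (fun p => p.1)
      (fun p => p.2) fun p x t => jetSeminorm_jet_le n p t x
  · exact continuous_smul.comp ((continuous_spectrumHom hA).prodMap continuous_id)

theorem mainTheorem7
    {A : Type*} [Ring A] [Algebra ℂ A] [UniformSpace A] [IsUniformAddGroup A]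
    [ContinuousSMul ℂ A] [StarRing A] [StarModule ℂ A] [ContinuousStar A]
    (hA : IsStereotypeAlgebra A)
    {X : Type*} [AddCommGroup X] [Module ℂ X] [Module A X] [IsScalarTower ℂ A X]
    [UniformSpace X] [IsUniformAddGroup X] [ContinuousSMul ℂ X]
    (hX : IsStereotypeModule A X) (n : ℕ) :
    ∃ τ : TopologicalSpace (Σ t : InvolutiveSpectrum A, Jet X n t),
      ∃ h : IsLocallyConvexBundle
          (fun (p : {p : Seminorm ℂ X // Continuous p}) (t : InvolutiveSpectrum A) =>
            jetSeminorm X n p t) τ,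
      ∃ hj : ∀ x : X, (fun t : InvolutiveSpectrum A => jet n x t) ∈ h.Sec,
        Continuous (fun x : X => (⟨fun t => jet n x t, hj x⟩ : h.Sec)) ∧
        Continuous (fun z : A × h.Sec => spectrumHom A z.1 • z.2) ∧
        @TopologicalSpace.IsTopologicalBasis _ τ
          {W | ∃ (x : X) (U : Set (InvolutiveSpectrum A))
            (p : {p : Seminorm ℂ X // Continuous p}) (ε : ℝ),
            IsOpen U ∧ 0 < ε ∧ W = jetBasicSet n x U p ε} ∧
        ∀ τ' : TopologicalSpace (Σ t : InvolutiveSpectrum A, Jet X n t),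
          IsLocallyConvexBundle
            (fun (p : {p : Seminorm ℂ X // Continuous p}) (t : InvolutiveSpectrum A) =>
              jetSeminorm X n p t) τ' →
          (∀ x : X, Continuous[_, τ'] fun t : InvolutiveSpectrum A =>
            (⟨t, jet n x t⟩ : Σ t : InvolutiveSpectrum A, Jet X n t)) →
          τ' = τ := by
  have := hX.continuousConstSMul
  have := hX.stereotype.polynormableSpace
  exact mainTheorem7_general hA.stereotype.continuous n
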